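/- **Formulae.** Fix sets of variables $\mathrm{Var}_*$ and $\mathrm{Var}_\omega$. Finite formulae $F$ and $\omega$-formulae $\Omega$ are given by $$F ::= \mathrm{Var}_* \mid F\cdot F \mid F\backslash F \mid F/F \mid F\vee F\mid F\wedge F\mid \Omega/\Omega\mid F^*,\qquad \Omega ::= \mathrm{Var}_\omega\mid F\cdot\Omega\mid F\backslash\Omega\mid\Omega\vee\Omega\mid\Omega\wedge\Omega\mid F^\omega .$$ **Sequents.** A correct sequence is a finite (possibly empty) sequence of finite formulae (type 1), an infinite sequence $A_1,A_2,\dots$ of finite formulae (type 2), or a finite sequence of finite formulae followed by one $\omega$-formula (type 3). A sequent is $\Theta\vdash B$ where $\Theta$ is of type 1 and $B$ is a finite formula, or $\Theta$ is of type 2 or 3 and $B$ is an $\omega$-formula. Below $\Gamma,\Pi,\Gamma_i,\Delta_i,\Pi_i$ are of type 1, $\Theta,\Xi$ are of any type, and all premises and conclusions of rules are sequents. **Calculus.** The infinitary action logic with omega iteration has the axioms $A\vdash A$ and the following rules; derivations are well-founded trees. Left rules: * $(\cdot L)$ from $\Gamma,A,B,\Theta\vdash E$ infer $\Gamma,A\cdot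 B,\Theta\vdash E$; * $(\backslash L)$ from $\Gamma,A,\Theta\vdash E$ and $\Pi\vdash B$ infer $\Gamma,\Pi,B\backslash A,\Theta\vdash E$; * $(/L)$ from $\Gamma,A,\Theta\vdash E$ and $\Xi\vdash D$ infer $\Gamma,A/D,\Xi,\Theta\vdash E$; * $(\wedge L)$ from $\Gamma,A_i,\Theta\vdash E$ for $i=1$ or $i=2$ infer $\Gamma,A_1\wedge A_2,\Theta\vdash E$; * $(\vee L)$ from $\Gamma,A_1,\Theta\vdash E$ and $\Gamma,A_2,\Theta\vdash E$ infer $\Gamma,A_1\vee A_2,\Theta\vdash E$; * $({}^*L)$ from $\Gamma,A^n,\Theta\vdash E$ for all $n\in\omega$ infer $\Gamma,A^*,\Theta\vdash E$, where $A^n$ is the sequence of $n$ copies of $A$; * $({}^\omega L)$ from $\Gamma,A,A,A,\ldots\vdash E$ infer $\Gamma,A^\omega\vdash E$; * $(L_\omega)$ from $\Delta_i\Vdash M_i$ $(i<\omega)$ and all those $\Gamma_0,\Gamma_1,\ldots\vdash C$ with $\Gamma_i\in M_i$ for all $i<\omega$ that are sequents (that is, with infinitely many $\Gamma_i$ non-empty)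 infer $\Delta_0,\Delta_1,\ldots\vdash C$. Here $\Theta\Vdash M$ means that, for a fresh variable $x$, there is a derivation of $\Theta\vdash x$ from hypotheses $\Xi\vdash x$ with $\Xi\in M$, using all of them, in which every sequent with succedent $x$ is a hypothesis or is obtained by one of the left rules other than $(L_\omega)$; the minor premises $\Pi\vdash B$ and $\Xi\vdash D$ of $(\backslash L)$ and $(/L)$ are required to be derivable in the calculus. Right rules: * $({}^\omega R)$ from $\Gamma_i\vdash A$ $(i<\omega)$ infer $\Gamma_0,\Gamma_1,\ldots\vdash A^\omega$; * $(/R)$ from $\Pi,B\vdash A$ infer $\Pi\vdash A/B$; * $(\backslash R)$ from $B,\Theta\vdash A$ infer $\Theta\vdash B\backslash A$; * $(\cdot R)$ from $\Gamma\vdash A$ and $\Theta\vdash B$ infer $\Gamma,\Theta\vdash A\cdot B$; * $(\wedge R)$ from $\Theta\vdash A_1$ and $\Theta\vdash A_2$ infer $\Theta\vdash A_1\wedge A_2$; * $(\vee R)$ from $\Theta\vdash A_i$ for $i=1$ or $i=2$ infer $\Theta\vdash A_1\vee A_2$; * $({}^*R)$ for $n\in\omega$, from $\Pi_i\vdash A$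 $(i<n)$ infer $\Pi_0,\dots,\Pi_{n-1}\vdash A^*$. **Theorem.** For every $\alpha\le\omega$ the rule $$(\mathrm{mix}_\alpha)\qquad \frac{(\Pi_i\vdash A_i)_{i<\alpha}\qquad \Sigma,\langle A_i,\Psi_i\rangle_{i<\alpha}\vdash C}{\Sigma,\langle \Pi_i,\Psi_i\rangle_{i<\alpha}\vdash C},$$ in which the sizes of the formulae $A_i$ are bounded by some $K\in\omega$ and premises and conclusion are sequents (so $\Sigma$, $\Pi_i$, $\Psi_i$ are correct sequences of types that make them so), is admissible: if the premises are derivable, then so is the conclusion. Consequently the cut rule (from $\Pi\vdash A$ and $\Gamma,A,\Theta\vdash C$ infer $\Gamma,\Pi,\Theta\vdash C$, where $\Pi$ may be of any type that makes these sequents) is admissible, and the rules $(\vee L)$, $(\wedge R)$, $(\cdot L)$, $(\backslash R)$, $(/R)$, $({}^*L)$ and $({}^\omega L)$ are invertible: if the conclusion of an instance of the rule is derivable, then so is each of its premises. -/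

import Mathlib

universe u v

/-- The two sorts of formulae: finite formulae and omega-formulae. -/
inductive Srt : Type
  | fin
  | om

/-- Formulae over the variable sets `V` (finite sort) and `W` (omega sort).
`Fml V W .fin` is the set of finite formulae `F`, `Fml V W .om` the set of omega-formulae `Ω`.
The sort parameter `s` merges the cases `F·F`, `F·Ω`; `F\F`, `F\Ω`; `F/F`, `Ω/Ω`; etc. -/
inductive Fml (V : Type u) (W : Type v) : Srt → Type (max u v)
  | fvar : V → Fml V W .fin
  | ovar : W → Fml V W .om
  | mul {s : Srt} : Fml V W .fin → Fml V W s → Fml V W s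
  /-- `ldiv B A` is `B \ A`. -/
  | ldiv {s : Srt} : Fml V W .fin → Fml V W s → Fml V W s
  /-- `rdiv A B` is `A / B`. -/
  | rdiv {s : Srt} : Fml V W s → Fml V W s → Fml V W .fin
  | or {s : Srt} : Fml V W s → Fml V W s → Fml V W s
  | and {s : Srt} : Fml V W s → Fml V W s → Fml V W s
  | star : Fml V W .fin → Fml V W .fin
  | omega : Fml V W .fin → Fml V W .om

/-- The size of a formula: its number of subformula occurrences. -/
def Fml.size {V W : Type*} : {s : Srt} → Fml V W s → ℕ
  | _, .fvar _ => 1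
  | _, .ovar _ => 1
  | _, .mul A B => A.size + B.size + 1
  | _, .ldiv A B => A.size + B.size + 1
  | _, .rdiv A B => A.size + B.size + 1
  | _, .or A B => A.size + B.size + 1
  | _, .and A B => A.size + B.size + 1
  | _, .star A => A.size + 1
  | _, .omega A => A.size + 1

/-- Correct sequences. `fin`: type 1, `inf`: type 2, `mixed`: type 3. The index is the sort that
the succedent must have, so a sequent is a pair of an `Ante V W s` and an `Fml V W s`. -/
inductive Ante (V : Type u) (W : Type v) : Srt → Type (max u v)
  | fin : List (Fml V W .fin) → Ante V W .fin
  | inf : Stream' (Fml V W .fin) → Ante V W .om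
  | mixed : List (Fml V W .fin) → Fml V W .om → Ante V W .om

/-- The sequence consisting of one formula. -/
def Ante.single {V W : Type*} : {s : Srt} → Fml V W s → Ante V W s
  | .fin, A => .fin [A]
  | .om, A => .mixed [] A

/-- The sequence `Γ, Θ`. -/
def Ante.prepend {V W : Type*} (Γ : List (Fml V W .fin)) : {s : Srt} → Ante V W s → Ante V W s
  | _, .fin Δ => .fin (Γ ++ Δ)
  | _, .inf f => .inf (Stream'.appendStream' Γ f)
  | _, .mixed Δ A => .mixed (Γ ++ Δ) A

/-- Contexts `Γ, [ ], Θ` whose hole takes a sequence of sort `s'` and which then form a sequence of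
sort `s`. After a sequence of sort `om` nothing can follow. -/
inductive Cx (V : Type u) (W : Type v) : Srt → Srt → Type (max u v)
  | mid {s : Srt} : List (Fml V W .fin) → Ante V W s → Cx V W .fin s
  | last : List (Fml V W .fin) → Cx V W .om .om

/-- Put a sequence into the hole of a context. -/
def Cx.plug {V W : Type*} : {s' s : Srt} → Cx V W s' s → Ante V W s' → Ante V W s
  | _, _, .mid Γ Θ, .fin P => Ante.prepend Γ (Ante.prepend P Θ)
  | _, _, .last Γ, X => Ante.prepend Γ X

/-- `f` is the infinite sequence `Γ 0, Γ 1, Γ 2, …`. There is no such `f` when all but finitely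
many of the lists `Γ i` are empty, and exactly one otherwise. -/
def IsConcat {α : Type*} (Γ : ℕ → List α) (f : Stream' α) : Prop :=
  (∀ n, ∃ t : Stream' α, f = Stream'.appendStream' ((List.range n).flatMap Γ) t) ∧
    ∀ m, ∃ n, m ≤ ((List.range n).flatMap Γ).length

mutual

/-- Derivability of the sequent `Θ ⊢ E` in the infinitary action logic with omega iteration. -/
inductive Der {V : Type u} {W : Type v} : {s : Srt} → Ante V W s → Fml V W s → Prop
  | ax {s : Srt} (A : Fml V W s) : Der (.single A) A
  | mulL {s' s : Srt} (c : Cx V W s' s) (A : Fml V W .fin) (B : Fml V W s') (E : Fml V W s) :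
      Der (c.plug (.prepend [A] (.single B))) E → Der (c.plug (.single (.mul A B))) E
  | ldivL {s' s : Srt} (c : Cx V W s' s) (P : List (Fml V W .fin)) (B : Fml V W .fin)
      (A : Fml V W s') (E : Fml V W s) :
      Der (c.plug (.single A)) E → Der (.fin P) B →
      Der (c.plug (.prepend P (.single (.ldiv B A)))) E
  | rdivL {s' s : Srt} (c : Cx V W s' s) (X : Ante V W s') (A D : Fml V W s') (E : Fml V W s) :
      Der (c.plug (.single A)) E → Der X D → Der (c.plug (.prepend [.rdiv A D] X)) E
  | andL₁ {s' s : Srt} (c : Cx V W s' s) (A B : Fml V W s') (E : Fml V W s) :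
      Der (c.plug (.single A)) E → Der (c.plug (.single (.and A B))) E
  | andL₂ {s' s : Srt} (c : Cx V W s' s) (A B : Fml V W s') (E : Fml V W s) :
      Der (c.plug (.single B)) E → Der (c.plug (.single (.and A B))) E
  | orL {s' s : Srt} (c : Cx V W s' s) (A B : Fml V W s') (E : Fml V W s) :
      Der (c.plug (.single A)) E → Der (c.plug (.single B)) E →
      Der (c.plug (.single (.or A B))) E
  | starL {s : Srt} (c : Cx V W .fin s) (A : Fml V W .fin) (E : Fml V W s) :
      (∀ n : ℕ, Der (c.plug (.fin (List.replicate n A))) E) → Der (c.plug (.single (.star A))) E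
  | omegaL {s : Srt} (c : Cx V W .om s) (A : Fml V W .fin) (E : Fml V W s) :
      Der (c.plug (.inf (Stream'.const A))) E → Der (c.plug (.single (.omega A))) E
  /-- The infinitary left rule. The premises are the sequents `Γ 0, Γ 1, … ⊢ C` with `Γ i ∈ M i`;
  a choice of the `Γ i` whose concatenation is finite does not form a sequent (the succedent is an
  omega-formula) and gives no premise. -/
  | Lω (Δ : ℕ → List (Fml V W .fin)) (M : ℕ → Set (Ante V W .fin)) (θ : Stream' (Fml V W .fin))
      (C : Fml V W .om) :
      IsConcat Δ θ → (∀ i, Red (.fin (Δ i)) (M i)) →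
      (∀ (Γ : ℕ → List (Fml V W .fin)) (g : Stream' (Fml V W .fin)),
        (∀ i, Ante.fin (Γ i) ∈ M i) → IsConcat Γ g → Der (.inf g) C) →
      Der (.inf θ) C
  | omegaR (Γ : ℕ → List (Fml V W .fin)) (θ : Stream' (Fml V W .fin)) (A : Fml V W .fin) :
      IsConcat Γ θ → (∀ i, Der (.fin (Γ i)) A) → Der (.inf θ) (.omega A)
  | rdivR {s : Srt} (P : List (Fml V W .fin)) (A B : Fml V W s) :
      Der (.prepend P (.single B)) A → Der (.fin P) (.rdiv A B)
  | ldivR {s : Srt} (Θ : Ante V W s) (B : Fml V W .fin) (A : Fml V W s) :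
      Der (.prepend [B] Θ) A → Der Θ (.ldiv B A)
  | mulR {s : Srt} (Γ : List (Fml V W .fin)) (Θ : Ante V W s) (A : Fml V W .fin) (B : Fml V W s) :
      Der (.fin Γ) A → Der Θ B → Der (.prepend Γ Θ) (.mul A B)
  | andR {s : Srt} (Θ : Ante V W s) (A B : Fml V W s) :
      Der Θ A → Der Θ B → Der Θ (.and A B)
  | orR₁ {s : Srt} (Θ : Ante V W s) (A B : Fml V W s) : Der Θ A → Der Θ (.or A B)
  | orR₂ {s : Srt} (Θ : Ante V W s) (A B : Fml V W s) : Der Θ B → Der Θ (.or A B)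
  | starR (P : List (List (Fml V W .fin))) (A : Fml V W .fin) :
      (∀ Q ∈ P, Der (.fin Q) A) → Der (.fin P.flatten) (.star A)

/-- `Red Θ M` is `Θ ⊩ M`: for a fresh variable `x` there is a derivation of `Θ ⊢ x` from the
hypotheses `Ξ ⊢ x`, `Ξ ∈ M`, in which every sequent with succedent `x` is a hypothesis or the
conclusion of a left rule other than `Lω`, and whose set of used hypotheses is exactly `M`.
The minor premises of the division rules, which do not contain `x`, are derivable sequents. -/
inductive Red {V : Type u} {W : Type v} : {s : Srt} → Ante V W s → Set (Ante V W s) → Prop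
  | hyp {s : Srt} (Θ : Ante V W s) : Red Θ {Θ}
  | mulL {s' s : Srt} (c : Cx V W s' s) (A : Fml V W .fin) (B : Fml V W s')
      (M : Set (Ante V W s)) :
      Red (c.plug (.prepend [A] (.single B))) M → Red (c.plug (.single (.mul A B))) M
  | ldivL {s' s : Srt} (c : Cx V W s' s) (P : List (Fml V W .fin)) (B : Fml V W .fin)
      (A : Fml V W s') (M : Set (Ante V W s)) :
      Red (c.plug (.single A)) M → Der (.fin P) B →
      Red (c.plug (.prepend P (.single (.ldiv B A)))) M
  | rdivL {s' s : Srt} (c : Cx V W s' s) (X : Ante V W s') (A D : Fml V W s')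
      (M : Set (Ante V W s)) :
      Red (c.plug (.single A)) M → Der X D → Red (c.plug (.prepend [.rdiv A D] X)) M
  | andL₁ {s' s : Srt} (c : Cx V W s' s) (A B : Fml V W s') (M : Set (Ante V W s)) :
      Red (c.plug (.single A)) M → Red (c.plug (.single (.and A B))) M
  | andL₂ {s' s : Srt} (c : Cx V W s' s) (A B : Fml V W s') (M : Set (Ante V W s)) :
      Red (c.plug (.single B)) M → Red (c.plug (.single (.and A B))) M
  | orL {s' s : Srt} (c : Cx V W s' s) (A B : Fml V W s') (M N : Set (Ante V W s)) :
      Red (c.plug (.single A)) M → Red (c.plug (.single B)) N →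
      Red (c.plug (.single (.or A B))) (M ∪ N)
  | starL {s : Srt} (c : Cx V W .fin s) (A : Fml V W .fin) (M : ℕ → Set (Ante V W s)) :
      (∀ n : ℕ, Red (c.plug (.fin (List.replicate n A))) (M n)) →
      Red (c.plug (.single (.star A))) (⋃ n, M n)
  | omegaL {s : Srt} (c : Cx V W .om s) (A : Fml V W .fin) (M : Set (Ante V W s)) :
      Red (c.plug (.inf (Stream'.const A))) M → Red (c.plug (.single (.omega A))) M

end

/-- `Σ, A₀, Ψ₀, …, Aₙ₋₁, Ψₙ₋₁` and (with lists `P i` in place of the formulae `A i`)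
`Σ, Π₀, Ψ₀, …, Πₙ₋₁, Ψₙ₋₁`. -/
def finBlocks {α : Type*} {n : ℕ} (S : List α) (P Q : Fin n → List α) : List α :=
  S ++ (List.ofFn fun i => P i ++ Q i).flatten

/-- Admissibility of the mix rule for finite `n`, all of whose cut formulae are finite formulae.
The last `Ψ` (or `Σ` when `n = 0`) may be of any type: it is continued by an arbitrary `Θ`. The
bound on the sizes of finitely many formulae is automatic. -/
def MixFinAdmissible (V W : Type*) (n : ℕ) : Prop :=
  ∀ (s : Srt) (S : List (Fml V W .fin)) (A : Fin n → Fml V W .fin)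
    (P Q : Fin n → List (Fml V W .fin)) (Θ : Ante V W s) (C : Fml V W s),
    (∀ i, Der (.fin (P i)) (A i)) →
    Der (.prepend (finBlocks S (fun i => [A i]) Q) Θ) C →
    Der (.prepend (finBlocks S P Q) Θ) C

/-- Admissibility of the mix rule for `n + 1` formulae, the last of which is an omega-formula `B`
(it is then the last formula of the antecedent), cut against `X ⊢ B`. -/
def MixFinOmAdmissible (V W : Type*) (n : ℕ) : Prop :=
  ∀ (S : List (Fml V W .fin)) (A : Fin n → Fml V W .fin)
    (P Q : Fin n → List (Fml V W .fin)) (X : Ante V W .om) (B C : Fml V W .om),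
    (∀ i, Der (.fin (P i)) (A i)) → Der X B →
    Der (.prepend (finBlocks S (fun i => [A i]) Q) (.single B)) C →
    Der (.prepend (finBlocks S P Q) X) C

/-- Admissibility of the mix rule for `ω` formulae of bounded size: `f` is `⟨Aᵢ, Ψᵢ⟩` and
`g` is `⟨Πᵢ, Ψᵢ⟩`, which has to be infinite for the conclusion to be a sequent. -/
def MixOmegaAdmissible (V W : Type*) : Prop :=
  ∀ (S : List (Fml V W .fin)) (A : ℕ → Fml V W .fin) (P Q : ℕ → List (Fml V W .fin))
    (f g : Stream' (Fml V W .fin)) (C : Fml V W .om),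
    (∃ K : ℕ, ∀ i, (A i).size ≤ K) →
    IsConcat (fun i => [A i] ++ Q i) f → IsConcat (fun i => P i ++ Q i) g →
    (∀ i, Der (.fin (P i)) (A i)) →
    Der (.prepend S (.inf f)) C → Der (.prepend S (.inf g)) C

/-- Admissibility of cut: from `Π ⊢ A` and `Γ, A, Θ ⊢ C` infer `Γ, Π, Θ ⊢ C`. -/
def CutAdmissible (V W : Type*) : Prop :=
  ∀ (s' s : Srt) (c : Cx V W s' s) (X : Ante V W s') (A : Fml V W s') (C : Fml V W s),
    Der X A → Der (c.plug (.single A)) C → Der (c.plug X) C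

/-! ### Concatenations of sequences of lists -/

section Concat

variable {α β : Type*}

-- All forms of mix are instances of `MixBelow`: derivability survives the simultaneous replacement,
-- in the antecedent, of any number of formulae of size at most `K` by sequences that derive them.
-- Simultaneity is essential, since `^ωL` turns one cut formula into infinitely many, which finitely
-- many cuts could not remove. The common bound `K` carries an outer induction.
--
-- For fixed `K` the induction is on the derivation being cut into (`mixBelow_of_lt`). Right rules
-- commute with replacement. At a left rule the replacement splits into one in the context and one
-- of the principal formula `F`. If `F` is replaced by `X` with `X ⊢ F` derivable,
-- `LeftClosed.of_der` follows that derivation upwards: its left rules can be performed inside the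
-- context, until an axiom or a right rule introducing `F` is met. The premises of the right rule
-- then justify replacing immediate subformulae of `F`, and these replacements join those already
-- made in the context, so the inner induction hypothesis applies. Only the divisions need the outer
-- hypothesis, to substitute the minor premise into the premise of the right rule.
--
-- Because of `Lω`, reductions `Red` must be transformed along with derivations. Having no
-- succedent, they are handled by stating each left step for an arbitrary `LeftClosed` predicate;
-- derivability of a fixed succedent and reducibility into a fixed set are both of this kind.
--
-- Invertibility follows by cutting with a short derivable sequent.

theorem flatMap_range_mono (Γ : ℕ → List α) {m n : ℕ} (h : m ≤ n) :
    (List.range m).flatMap Γ <+: (List.range n).flatMap Γ := by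
  obtain ⟨k, rfl⟩ := Nat.exists_eq_add_of_le h
  rw [List.range_add, List.flatMap_append]
  exact List.prefix_append _ _

theorem flatMap_range_succ_left (Γ : ℕ → List α) (n : ℕ) :
    (List.range (n + 1)).flatMap Γ = Γ 0 ++ (List.range n).flatMap fun i => Γ (i + 1) := by
  rw [List.range_succ_eq_map, List.flatMap_cons, List.flatMap_map]

theorem flatMap_range_succ_right (Γ : ℕ → List α) (n : ℕ) :
    (List.range (n + 1)).flatMap Γ = (List.range n).flatMap Γ ++ Γ n := by
  rw [List.range_succ, List.flatMap_append, List.flatMap_singleton]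

theorem Stream'.exists_eq_append_of_isPrefix {l l' : List α} {f : Stream' α} (h : l <+: l')
    (hf : ∃ t, f = Stream'.appendStream' l' t) : ∃ t, f = Stream'.appendStream' l t := by
  obtain ⟨r, rfl⟩ := h
  obtain ⟨t, rfl⟩ := hf
  exact ⟨_, Stream'.append_append_stream _ _ _⟩

theorem Stream'.exists_eq_append_iff {l : List α} {f : Stream' α} :
    (∃ t, f = Stream'.appendStream' l t) ↔ f.take l.length = l := by
  constructor
  · rintro ⟨t, rfl⟩
    rw [Stream'.take_append_of_le_length _ _ _ le_rfl, List.take_length]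
  · intro h
    exact ⟨f.drop l.length, by conv_lhs => rw [← Stream'.append_take_drop l.length f, h]⟩

theorem Stream'.take_eq_map_range (f : Stream' α) (n : ℕ) :
    f.take n = (List.range n).map f.get := by
  induction n with
  | zero => rfl
  | succ n ih => rw [Stream'.take_succ', ih, List.range_succ, List.map_append]; rfl

theorem IsConcat.take_eq {Γ : ℕ → List α} {f : Stream' α} (h : IsConcat Γ f) (n : ℕ) :
    f.take ((List.range n).flatMap Γ).length = (List.range n).flatMap Γ :=
  Stream'.exists_eq_append_iff.1 (h.1 n)

theorem IsConcat.unique {Γ : ℕ → List α} {f g : Stream' α} (hf : IsConcat Γ f)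
    (hg : IsConcat Γ g) : f = g := by
  refine Stream'.take_theorem _ _ fun m => ?_
  obtain ⟨n, hn⟩ := hf.2 m
  have h := (hf.take_eq n).trans (hg.take_eq n).symm
  have h' := congrArg (List.take m) h
  rwa [Stream'.take_take, Stream'.take_take, min_eq_right hn] at h'

theorem IsConcat.succ {Γ : ℕ → List α} {f : Stream' α} (h : IsConcat Γ f) :
    ∃ t, f = Stream'.appendStream' (Γ 0) t ∧ IsConcat (fun i => Γ (i + 1)) t := by
  obtain ⟨t, ht⟩ := h.1 1
  rw [flatMap_range_succ_left, List.range_zero, List.flatMap_nil, List.append_nil] at ht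
  refine ⟨t, ht, fun n => ?_, fun m => ?_⟩
  · obtain ⟨r, hr⟩ := h.1 (n + 1)
    rw [flatMap_range_succ_left, Stream'.append_append_stream, ht,
      Stream'.append_right_inj] at hr
    exact ⟨r, hr⟩
  · obtain ⟨n, hn⟩ := h.2 (m + (Γ 0).length)
    refine ⟨n, ?_⟩
    have := (flatMap_range_mono Γ (Nat.le_succ n)).length_le
    rw [Nat.succ_eq_add_one, flatMap_range_succ_left, List.length_append] at this
    omega

theorem IsConcat.of_succ {Γ : ℕ → List α} {t : Stream' α}
    (h : IsConcat (fun i => Γ (i + 1)) t) : IsConcat Γ (Stream'.appendStream' (Γ 0) t) := by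
  refine ⟨fun n => ?_, fun m => ?_⟩
  · refine Stream'.exists_eq_append_of_isPrefix (flatMap_range_mono Γ (Nat.le_succ n)) ?_
    obtain ⟨r, hr⟩ := h.1 n
    exact ⟨r, by
      rw [Nat.succ_eq_add_one, flatMap_range_succ_left, Stream'.append_append_stream, ← hr]⟩
  · obtain ⟨n, hn⟩ := h.2 m
    refine ⟨n + 1, ?_⟩
    rw [flatMap_range_succ_left, List.length_append]
    omega

/-- The sequence `a, Γ 0, Γ 1, …`. -/
def consSeq {γ : Type*} (a : γ) (Γ : ℕ → γ) : ℕ → γ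
  | 0 => a
  | n + 1 => Γ n

theorem IsConcat.consSeq {Γ : ℕ → List α} {t : Stream' α} (h : IsConcat Γ t) (l : List α) :
    IsConcat (consSeq l Γ) (Stream'.appendStream' l t) :=
  IsConcat.of_succ (Γ := _root_.consSeq l Γ) h

theorem unbounded_iff_frequently_ne_nil (Γ : ℕ → List α) :
    (∀ m, ∃ n, m ≤ ((List.range n).flatMap Γ).length) ↔ ∀ N, ∃ i, N ≤ i ∧ Γ i ≠ [] := by
  constructor
  · intro h N
    by_contra! hN
    obtain ⟨n, hn⟩ := h (((List.range N).flatMap Γ).length + 1)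
    have key : ∀ k, (List.range (N + k)).flatMap Γ = (List.range N).flatMap Γ := by
      intro k
      induction k with
      | zero => rfl
      | succ k ih => rw [← add_assoc, flatMap_range_succ_right, ih, hN _ (by omega), List.append_nil]
    have := (flatMap_range_mono Γ (show n ≤ N + n by omega)).length_le
    rw [key] at this
    omega
  · intro h m
    induction m with
    | zero => exact ⟨0, Nat.zero_le _⟩
    | succ m ih =>
      obtain ⟨n, hn⟩ := ih
      obtain ⟨i, hi, hne⟩ := h n
      refine ⟨i + 1, ?_⟩
      have h1 := (flatMap_range_mono Γ hi).length_le
      have h2 := List.length_pos_iff.2 hne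
      rw [flatMap_range_succ_right, List.length_append]
      omega

theorem exists_isConcat (Γ : ℕ → List α)
    (h : ∀ m, ∃ n, m ≤ ((List.range n).flatMap Γ).length) : ∃ f, IsConcat Γ f := by
  choose N hN using h
  -- Entry `k` is read off a partial concatenation of length greater than `k`; these are nested, so
  -- it does not matter which one is used.
  let f : Stream' α := fun k =>
    ((List.range (N (k + 1))).flatMap Γ)[k]'(lt_of_lt_of_le (Nat.lt_succ_self k) (hN (k + 1)))
  refine ⟨f, fun n => Stream'.exists_eq_append_iff.2 ?_, fun m => ⟨N m, hN m⟩⟩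
  refine List.ext_getElem (by simp) fun k h1 h2 => ?_
  rw [Stream'.take_get]
  have hlt := lt_of_lt_of_le (Nat.lt_succ_self k) (hN (k + 1))
  change ((List.range (N (k + 1))).flatMap Γ)[k]'hlt = _
  rcases le_total n (N (k + 1)) with hle | hle
  · exact ((flatMap_range_mono Γ hle).getElem h2).symm
  · exact (flatMap_range_mono Γ hle).getElem hlt

theorem IsConcat.map {Γ : ℕ → List α} {f : Stream' α} (h : IsConcat Γ f) (φ : α → β) :
    IsConcat (fun i => (Γ i).map φ) (f.map φ) := by
  refine ⟨fun n => ?_, fun m => ?_⟩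
  · obtain ⟨t, ht⟩ := h.1 n
    refine ⟨t.map φ, ?_⟩
    rw [ht, Stream'.map_append_stream, List.map_flatMap]
  · obtain ⟨n, hn⟩ := h.2 m
    refine ⟨n, ?_⟩
    rwa [← List.map_flatMap, List.length_map]

/-- Grouping the members of a sequence of lists into blocks does not change its concatenation. -/
theorem IsConcat.flatMap_iff {Z : ℕ → List α} {z : Stream' α} (h : IsConcat Z z)
    (φ : α → List β) (g : Stream' β) :
    IsConcat (fun i => (Z i).flatMap φ) g ↔ IsConcat (fun i => φ (z.get i)) g := by
  -- The first `n` blocks exhaust an initial segment of `z`, so the partial concatenations on the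
  -- left are cofinal among those on the right.
  have key (n : ℕ) : (List.range n).flatMap (fun i => (Z i).flatMap φ) =
      (List.range ((List.range n).flatMap Z).length).flatMap fun i => φ (z.get i) := by
    rw [← List.flatMap_assoc, ← h.take_eq n, Stream'.take_eq_map_range, List.flatMap_map,
      List.length_map, List.length_range]
  constructor
  · intro hg
    refine ⟨fun k => ?_, fun m => ?_⟩
    · obtain ⟨n, hn⟩ := h.2 k
      refine Stream'.exists_eq_append_of_isPrefix (flatMap_range_mono _ hn) ?_
      rw [← key]
      exact hg.1 n
    · obtain ⟨n, hn⟩ := hg.2 m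
      exact ⟨_, by rwa [key] at hn⟩
  · intro hg
    refine ⟨fun n => ?_, fun m => ?_⟩
    · rw [key]
      exact hg.1 _
    · obtain ⟨k, hk⟩ := hg.2 m
      obtain ⟨n, hn⟩ := h.2 k
      refine ⟨n, ?_⟩
      rw [key]
      exact hk.trans (flatMap_range_mono _ hn).length_le

theorem IsConcat.singleton (f : Stream' α) : IsConcat (fun i => [f.get i]) f := by
  have key (n : ℕ) : (List.range n).flatMap (fun i => [f.get i]) = f.take n := by
    rw [Stream'.take_eq_map_range, List.map_eq_flatMap]
  exact ⟨fun n => ⟨f.drop n, by rw [key, Stream'.append_take_drop]⟩,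
    fun m => ⟨m, by rw [key, Stream'.length_take]⟩⟩

/-- A stream cut along the lengths of the lists of a concatenation. -/
theorem IsConcat.exists_lift {Γ : ℕ → List α} {z : Stream' β} {φ : β → α}
    (h : IsConcat Γ (z.map φ)) : ∃ Z : ℕ → List β, IsConcat Z z ∧ ∀ i, (Z i).map φ = Γ i := by
  let l : ℕ → ℕ := fun n => ((List.range n).flatMap Γ).length
  have hl (n : ℕ) : l (n + 1) = l n + (Γ n).length := by
    simp only [l, flatMap_range_succ_right, List.length_append]
  -- `l n` is the position at which block `n` starts.
  let Z : ℕ → List β := fun n => (z.drop (l n)).take (Γ n).length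
  have hZ (n : ℕ) : (List.range n).flatMap Z = z.take (l n) := by
    induction n with
    | zero => rfl
    | succ n ih => rw [flatMap_range_succ_right, ih, hl, Stream'.take_add]
  have hmap (k : ℕ) (s : Stream' β) : (s.take k).map φ = (s.map φ).take k := by
    rw [Stream'.take_eq_map_range, Stream'.take_eq_map_range, List.map_map]; rfl
  refine ⟨Z, ⟨fun n => Stream'.exists_eq_append_iff.2 (by rw [hZ, Stream'.length_take]),
    fun m => ?_⟩, fun n => ?_⟩
  · obtain ⟨n, hn⟩ := h.2 m
    exact ⟨n, by rwa [hZ, Stream'.length_take]⟩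
  · have h1 := h.take_eq (n + 1)
    have h0 := h.take_eq n
    change (z.map φ).take (l (n + 1)) = _ at h1
    change (z.map φ).take (l n) = _ at h0
    rw [flatMap_range_succ_right, hl, Stream'.take_add, h0, List.append_cancel_left_eq] at h1
    rw [hmap]
    exact h1

end Concat

/-! ### Replacing the members of a sequence by lists -/

section Replace

variable {α β : Type*} {r : α → List β → Prop}

/-- `ListSub r l l'`: the list `l'` arises from `l` by replacing each member `a` by a list `p`
with `r a p`. -/
inductive ListSub (r : α → List β → Prop) : List α → List β → Prop
  | nil : ListSub r [] []
  | cons {a : α} {p : List β} {l : List α} {l' : List β} :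
      r a p → ListSub r l l' → ListSub r (a :: l) (p ++ l')

/-- `StreamSub r f g`: the stream `g` arises from `f` by replacing each member `a` by a list `p`
with `r a p`. -/
def StreamSub (r : α → List β → Prop) (f : Stream' α) (g : Stream' β) : Prop :=
  ∃ P : ℕ → List β, (∀ i, r (f.get i) (P i)) ∧ IsConcat P g

theorem ListSub.append {l₁ l₂ : List α} {m₁ m₂ : List β} (h₁ : ListSub r l₁ m₁)
    (h₂ : ListSub r l₂ m₂) : ListSub r (l₁ ++ l₂) (m₁ ++ m₂) := by
  induction h₁ with
  | nil => exact h₂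
  | cons ha _ ih => rw [List.append_assoc]; exact .cons ha ih

theorem ListSub.singleton {a : α} {p : List β} (h : r a p) : ListSub r [a] p := by
  simpa using ListSub.cons h .nil

theorem ListSub.of_singleton {a : α} {p : List β} (h : ListSub r [a] p) : r a p := by
  cases h with
  | cons ha h => cases h; simpa using ha

theorem ListSub.exists_append {l₁ l₂ : List α} {m : List β} (h : ListSub r (l₁ ++ l₂) m) :
    ∃ m₁ m₂, m = m₁ ++ m₂ ∧ ListSub r l₁ m₁ ∧ ListSub r l₂ m₂ := by
  induction l₁ generalizing m with
  | nil => exact ⟨[], m, rfl, .nil, h⟩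
  | cons a l₁ ih =>
    cases h with
    | cons ha h =>
      obtain ⟨m₁, m₂, rfl, h₁, h₂⟩ := ih h
      exact ⟨_, m₂, (List.append_assoc _ _ _).symm, .cons ha h₁, h₂⟩

theorem ListSub.exists_flatten {L : List (List α)} {m : List β} (h : ListSub r L.flatten m) :
    ∃ M : List (List β), m = M.flatten ∧ ∀ p ∈ M, ∃ l ∈ L, ListSub r l p := by
  induction L generalizing m with
  | nil => cases h; exact ⟨[], rfl, by simp⟩
  | cons l L ih =>
    obtain ⟨m₁, m₂, rfl, h₁, h₂⟩ := ListSub.exists_append h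
    obtain ⟨M, rfl, hM⟩ := ih h₂
    refine ⟨m₁ :: M, rfl, fun p hp => ?_⟩
    rcases List.mem_cons.1 hp with rfl | hp
    · exact ⟨l, List.mem_cons_self, h₁⟩
    · obtain ⟨l', hl', hs⟩ := hM p hp
      exact ⟨l', List.mem_cons_of_mem _ hl', hs⟩

theorem ListSub.replicate {a : α} {M : List (List β)} (h : ∀ p ∈ M, r a p) :
    ListSub r (List.replicate M.length a) M.flatten := by
  induction M with
  | nil => exact .nil
  | cons p M ih =>
    exact .cons (h p List.mem_cons_self) (ih fun q hq => h q (List.mem_cons_of_mem _ hq))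

theorem listSub_map_flatMap {Z : List (α × List β)} (h : ∀ z ∈ Z, r z.1 z.2) :
    ListSub r (Z.map Prod.fst) (Z.flatMap Prod.snd) := by
  induction Z with
  | nil => exact .nil
  | cons z Z ih =>
    exact .cons (h z List.mem_cons_self) (ih fun y hy => h y (List.mem_cons_of_mem _ hy))

theorem ListSub.exists_pairs {l : List α} {m : List β} (h : ListSub r l m) :
    ∃ Z : List (α × List β), Z.map Prod.fst = l ∧ Z.flatMap Prod.snd = m ∧
      ∀ z ∈ Z, r z.1 z.2 := by
  induction h with
  | nil => exact ⟨[], rfl, rfl, by simp⟩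
  | @cons a p l l' ha _ ih =>
    obtain ⟨Z, rfl, rfl, hZ⟩ := ih
    refine ⟨(a, p) :: Z, rfl, rfl, fun z hz => ?_⟩
    rcases List.mem_cons.1 hz with rfl | hz
    · exact ha
    · exact hZ z hz

theorem ListSub.refl {r : α → List α → Prop} (h : ∀ a, r a [a]) (l : List α) :
    ListSub r l l := by
  induction l with
  | nil => exact .nil
  | cons a l ih => exact .cons (h a) ih

theorem StreamSub.refl {r : α → List α → Prop} (h : ∀ a, r a [a]) (f : Stream' α) :
    StreamSub r f f :=
  ⟨fun i => [f.get i], fun _ => h _, .singleton f⟩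

theorem StreamSub.append {l : List α} {m : List β} {f : Stream' α} {g : Stream' β}
    (h₁ : ListSub r l m) (h₂ : StreamSub r f g) :
    StreamSub r (Stream'.appendStream' l f) (Stream'.appendStream' m g) := by
  induction h₁ with
  | nil => exact h₂
  | @cons a p l l' ha _ ih =>
    obtain ⟨P, hP, hg⟩ := ih
    refine ⟨consSeq p P, fun i => ?_, ?_⟩
    · cases i with
      | zero => exact ha
      | succ i => exact hP i
    · rw [Stream'.append_append_stream]
      exact hg.consSeq p

theorem StreamSub.exists_append {l : List α} {f : Stream' α} {g : Stream' β}
    (h : StreamSub r (Stream'.appendStream' l f) g) :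
    ∃ m g', g = Stream'.appendStream' m g' ∧ ListSub r l m ∧ StreamSub r f g' := by
  induction l generalizing g with
  | nil => exact ⟨[], g, rfl, .nil, h⟩
  | cons a l ih =>
    obtain ⟨P, hP, hg⟩ := h
    obtain ⟨t, rfl, ht⟩ := hg.succ
    obtain ⟨m, g', rfl, h₁, h₂⟩ := ih ⟨_, fun i => hP (i + 1), ht⟩
    exact ⟨P 0 ++ m, g', (Stream'.append_append_stream _ _ _).symm, .cons (hP 0) h₁, h₂⟩

/-- Each member is paired with its replacement; the stream of pairs is cut along the blocks of `Γ`,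
and the second components of each piece are concatenated. This distributes a replacement over the
blocks in `^ωR` and `Lω`. -/
theorem StreamSub.exists_isConcat {Γ : ℕ → List α} {f : Stream' α} {g : Stream' β}
    (hf : IsConcat Γ f) (h : StreamSub r f g) :
    ∃ Γ' : ℕ → List β, IsConcat Γ' g ∧ ∀ i, ListSub r (Γ i) (Γ' i) := by
  obtain ⟨P, hP, hg⟩ := h
  let z : Stream' (α × List β) := fun i => (f.get i, P i)
  obtain ⟨Z, hZ, hΓ⟩ := IsConcat.exists_lift (z := z) (φ := Prod.fst) hf
  refine ⟨fun i => (Z i).flatMap Prod.snd, (hZ.flatMap_iff _ _).2 hg, fun i => ?_⟩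
  rw [← hΓ i]
  refine listSub_map_flatMap fun y hy => ?_
  obtain ⟨n, rfl⟩ : ∃ n, z.get n = y := by
    have hmem : y ∈ (List.range (i + 1)).flatMap Z :=
      List.mem_flatMap.2 ⟨i, List.mem_range.2 (Nat.lt_succ_self i), hy⟩
    rw [← hZ.take_eq, Stream'.take_eq_map_range] at hmem
    obtain ⟨n, -, hn⟩ := List.mem_map.1 hmem
    exact ⟨n, hn⟩
  exact hP n

/-- An empty list can only be replaced by the empty list. Hence infinitely many non-empty `Γ' i`
force infinitely many non-empty `Γ i`, and the sources also form an infinite sequence. -/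
theorem exists_streamSub {Γ : ℕ → List α} {Γ' : ℕ → List β} {g : Stream' β}
    (hg : IsConcat Γ' g) (h : ∀ i, ListSub r (Γ i) (Γ' i)) :
    ∃ f, IsConcat Γ f ∧ StreamSub r f g := by
  choose Z hΓ hΓ' hr using fun i => (h i).exists_pairs
  obtain rfl : (fun i => (Z i).map Prod.fst) = Γ := funext hΓ
  obtain rfl : (fun i => (Z i).flatMap Prod.snd) = Γ' := funext hΓ'
  have hunb : ∀ m, ∃ n, m ≤ ((List.range n).flatMap Z).length := by
    rw [unbounded_iff_frequently_ne_nil]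
    intro N
    obtain ⟨i, hi, hne⟩ := (unbounded_iff_frequently_ne_nil _).1 hg.2 N
    refine ⟨i, hi, fun h0 => hne ?_⟩
    simp only [h0, List.flatMap_nil]
  obtain ⟨z, hz⟩ := _root_.exists_isConcat Z hunb
  refine ⟨z.map Prod.fst, hz.map _, fun i => (z.get i).2, fun i => ?_, (hz.flatMap_iff _ _).1 hg⟩
  change r (z.get i).1 (z.get i).2
  obtain ⟨n, hn⟩ := hz.2 (i + 1)
  have hmem : z.get i ∈ (List.range n).flatMap Z := by
    rw [← hz.take_eq, Stream'.take_eq_map_range]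
    exact List.mem_map_of_mem (List.mem_range.2 hn)
  obtain ⟨k, -, hk⟩ := List.mem_flatMap.1 hmem
  exact hr k _ hk

end Replace

section Antecedents

variable {V : Type u} {W : Type v}

/-! ### Contexts -/

theorem Ante.prepend_nil {s : Srt} (Θ : Ante V W s) : Ante.prepend [] Θ = Θ := by
  cases Θ <;> rfl

theorem Ante.prepend_prepend {s : Srt} (Γ Δ : List (Fml V W .fin)) (Θ : Ante V W s) :
    Ante.prepend Γ (Ante.prepend Δ Θ) = Ante.prepend (Γ ++ Δ) Θ := by
  cases Θ <;> simp [Ante.prepend, Stream'.append_append_stream]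

/-- The context `Γ, c`. -/
def Cx.prepend (Γ : List (Fml V W .fin)) : {s' s : Srt} → Cx V W s' s → Cx V W s' s
  | _, _, .mid Δ Θ => .mid (Γ ++ Δ) Θ
  | _, _, .last Δ => .last (Γ ++ Δ)

/-- The context `c, Θ`. -/
def Cx.append : {s' s : Srt} → Cx V W s' .fin → Ante V W s → Cx V W s' s
  | _, _, .mid Γ (.fin Δ), Θ => .mid Γ (Θ.prepend Δ)

/-- The context that arises from putting the context `d` into the hole of `c`. -/
def Cx.comp : {s₁ s₂ s₃ : Srt} → Cx V W s₂ s₃ → Cx V W s₁ s₂ → Cx V W s₁ s₃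
  | _, _, _, .mid Γ Θ, d => (d.append Θ).prepend Γ
  | _, _, _, .last Γ, d => d.prepend Γ

theorem Cx.plug_prepend {s' s : Srt} (Γ : List (Fml V W .fin)) (c : Cx V W s' s)
    (X : Ante V W s') : (c.prepend Γ).plug X = Ante.prepend Γ (c.plug X) := by
  cases c with
  | mid Δ Θ => cases X; simp only [Cx.prepend, Cx.plug, Ante.prepend_prepend, List.append_assoc]
  | last Δ => simp only [Cx.prepend, Cx.plug, Ante.prepend_prepend]

theorem Cx.plug_comp {s₁ s₂ s₃ : Srt} (c : Cx V W s₂ s₃) (d : Cx V W s₁ s₂) (X : Ante V W s₁) :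
    (c.comp d).plug X = c.plug (d.plug X) := by
  cases c with
  | mid Γ Θ =>
    rcases d with ⟨Δ, ⟨Ξ⟩⟩
    cases X
    simp only [Cx.comp, Cx.append, Cx.prepend, Cx.plug, Ante.prepend_prepend, List.append_assoc]
    rw [← List.append_assoc Δ]
    rfl
  | last Γ => exact Cx.plug_prepend Γ d X

/-- The empty context. -/
def Cx.hole : (s : Srt) → Cx V W s s
  | .fin => .mid [] (.fin [])
  | .om => .last []

theorem Cx.plug_hole {s : Srt} (X : Ante V W s) : (Cx.hole s).plug X = X := by
  cases X <;> simp [Cx.hole, Cx.plug, Ante.prepend]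

/-! ### Replacing the formulae of an antecedent -/

/-- `X` may replace the formula `A`: it is `A` itself, or `A` has size at most `K` and is
derivable from `X`. -/
def FmlRep (K : ℕ) {s : Srt} (A : Fml V W s) (X : Ante V W s) : Prop :=
  X = .single A ∨ A.size ≤ K ∧ Der X A

/-- `FmlRep` for a list of finite formulae. -/
def ListRep (K : ℕ) (A : Fml V W .fin) (p : List (Fml V W .fin)) : Prop :=
  FmlRep K A (.fin p)

/-- `AnteSub K Θ Θ'`: the sequence `Θ'` arises from `Θ` by replacing formulae `A` of size at most `K`
by sequences from which they are derivable. -/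
inductive AnteSub (K : ℕ) : {s : Srt} → Ante V W s → Ante V W s → Prop
  | fin {L L' : List (Fml V W .fin)} : ListSub (ListRep K) L L' → AnteSub K (.fin L) (.fin L')
  | inf {f g : Stream' (Fml V W .fin)} : StreamSub (ListRep K) f g → AnteSub K (.inf f) (.inf g)
  | mixed {L L' : List (Fml V W .fin)} {B : Fml V W .om} {X : Ante V W .om} :
      ListSub (ListRep K) L L' → FmlRep K B X → AnteSub K (.mixed L B) (.prepend L' X)

variable {K : ℕ}

theorem FmlRep.refl {s : Srt} (A : Fml V W s) : FmlRep K A (.single A) := .inl rfl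

theorem ListRep.refl (A : Fml V W .fin) : ListRep K A [A] := .inl rfl

theorem FmlRep.der {s : Srt} {A : Fml V W s} {X : Ante V W s} (h : FmlRep K A X) : Der X A := by
  rcases h with rfl | h
  · exact .ax A
  · exact h.2

theorem anteSub_fin_iff {L L' : List (Fml V W .fin)} :
    AnteSub K (.fin L) (.fin L') ↔ ListSub (ListRep K) L L' :=
  ⟨fun h => by cases h; assumption, .fin⟩

theorem AnteSub.exists_fin {L : List (Fml V W .fin)} {Θ : Ante V W .fin} (h : AnteSub K (.fin L) Θ) :
    ∃ L', Θ = .fin L' ∧ ListSub (ListRep K) L L' := by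
  cases h with
  | fin h => exact ⟨_, rfl, h⟩

theorem AnteSub.exists_inf {f : Stream' (Fml V W .fin)} {Θ : Ante V W .om} (h : AnteSub K (.inf f) Θ) :
    ∃ g, Θ = .inf g ∧ StreamSub (ListRep K) f g := by
  cases h with
  | inf h => exact ⟨_, rfl, h⟩

theorem AnteSub.exists_mixed {L : List (Fml V W .fin)} {B : Fml V W .om} {Θ : Ante V W .om}
    (h : AnteSub K (.mixed L B) Θ) :
    ∃ L' X, Θ = .prepend L' X ∧ ListSub (ListRep K) L L' ∧ FmlRep K B X := by
  cases h with
  | mixed h h' => exact ⟨_, _, rfl, h, h'⟩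

theorem AnteSub.refl {s : Srt} (Θ : Ante V W s) : AnteSub K Θ Θ := by
  cases Θ with
  | fin L => exact .fin (.refl ListRep.refl L)
  | inf f => exact .inf (.refl ListRep.refl f)
  | mixed L B =>
    simpa [Ante.prepend, Ante.single] using AnteSub.mixed (.refl ListRep.refl L) (FmlRep.refl B)

theorem AnteSub.single {s : Srt} {A : Fml V W s} {X : Ante V W s} (h : FmlRep K A X) :
    AnteSub K (.single A) X := by
  cases s with
  | fin => cases X; exact .fin (.singleton h)
  | om =>
    have := AnteSub.mixed (K := K) .nil h
    rwa [Ante.prepend_nil] at this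

theorem AnteSub.rep {s : Srt} {A : Fml V W s} {X : Ante V W s} (h : AnteSub K (.single A) X) :
    FmlRep K A X := by
  cases s with
  | fin =>
    obtain ⟨L, rfl, hL⟩ := AnteSub.exists_fin h
    exact hL.of_singleton
  | om =>
    obtain ⟨L, X, rfl, h, h'⟩ := AnteSub.exists_mixed h
    cases h
    rwa [Ante.prepend_nil]

theorem AnteSub.prepend {s : Srt} {Γ Γ' : List (Fml V W .fin)} {Θ Θ' : Ante V W s}
    (h : ListSub (ListRep K) Γ Γ') (h' : AnteSub K Θ Θ') : AnteSub K (Θ.prepend Γ) (Θ'.prepend Γ') := by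
  cases h' with
  | fin h₁ => exact .fin (h.append h₁)
  | inf h₁ => exact .inf (.append h h₁)
  | mixed h₁ h₂ =>
    rw [Ante.prepend_prepend]
    exact .mixed (h.append h₁) h₂

theorem AnteSub.exists_prepend {s : Srt} {Γ : List (Fml V W .fin)} {Θ Z : Ante V W s}
    (h : AnteSub K (Θ.prepend Γ) Z) :
    ∃ Γ' Θ', Z = Ante.prepend Γ' Θ' ∧ ListSub (ListRep K) Γ Γ' ∧ AnteSub K Θ Θ' := by
  cases Θ with
  | fin L =>
    obtain ⟨L', rfl, hL⟩ := AnteSub.exists_fin h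
    obtain ⟨m₁, m₂, rfl, h₁, h₂⟩ := hL.exists_append
    exact ⟨m₁, .fin m₂, rfl, h₁, .fin h₂⟩
  | inf f =>
    obtain ⟨g, rfl, hg⟩ := AnteSub.exists_inf h
    obtain ⟨m, g', rfl, h₁, h₂⟩ := hg.exists_append
    exact ⟨m, .inf g', rfl, h₁, .inf h₂⟩
  | mixed L B =>
    obtain ⟨L', X, rfl, h, hB⟩ := AnteSub.exists_mixed h
    obtain ⟨m₁, m₂, rfl, h₁, h₂⟩ := h.exists_append
    exact ⟨m₁, Ante.prepend m₂ X, (Ante.prepend_prepend _ _ _).symm, h₁, .mixed h₂ hB⟩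

/-- `CxSub K c c'`: the context `c'` arises from `c` by replacing formulae. -/
inductive CxSub (K : ℕ) : {s' s : Srt} → Cx V W s' s → Cx V W s' s → Prop
  | mid {s : Srt} {Γ Γ' : List (Fml V W .fin)} {Θ Θ' : Ante V W s} :
      ListSub (ListRep K) Γ Γ' → AnteSub K Θ Θ' → CxSub K (.mid Γ Θ) (.mid Γ' Θ')
  | last {Γ Γ' : List (Fml V W .fin)} :
      ListSub (ListRep K) Γ Γ' → CxSub K (.last Γ) (.last Γ')

theorem CxSub.refl {s' s : Srt} (c : Cx V W s' s) : CxSub K c c := by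
  cases c with
  | mid Γ Θ => exact .mid (.refl ListRep.refl Γ) (.refl Θ)
  | last Γ => exact .last (.refl ListRep.refl Γ)

theorem CxSub.plug {s' s : Srt} {c c' : Cx V W s' s} {X X' : Ante V W s'} (h : CxSub K c c')
    (hX : AnteSub K X X') : AnteSub K (c.plug X) (c'.plug X') := by
  cases h with
  | mid h₁ h₂ => cases hX with | fin h => exact .prepend h₁ (.prepend h h₂)
  | last h => exact .prepend h hX

/-- This separates the replacements around the active part of a left rule from those within it. -/
theorem AnteSub.exists_plug {s' s : Srt} {c : Cx V W s' s} {X : Ante V W s'} {Z : Ante V W s}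
    (h : AnteSub K (c.plug X) Z) : ∃ c' X', Z = c'.plug X' ∧ CxSub K c c' ∧ AnteSub K X X' := by
  cases c with
  | mid Γ Θ =>
    cases X with
    | fin L =>
      obtain ⟨Γ', Z', rfl, h₁, h⟩ := AnteSub.exists_prepend h
      obtain ⟨L', Θ', rfl, h₂, h₃⟩ := AnteSub.exists_prepend h
      exact ⟨.mid Γ' Θ', .fin L', rfl, .mid h₁ h₃, .fin h₂⟩
  | last Γ =>
    obtain ⟨Γ', Z', rfl, h₁, h⟩ := AnteSub.exists_prepend h
    exact ⟨.last Γ', Z', rfl, .last h₁, h⟩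

end Antecedents

section LeftRules

variable {V : Type u} {W : Type v}

/-! ### Predicates closed under the left rules -/

/-- The predicate `Q` on antecedents is closed under the left rules. -/
structure LeftClosed {s : Srt} (Q : Ante V W s → Prop) : Prop where
  mulL : ∀ {s' : Srt} (c : Cx V W s' s) (A : Fml V W .fin) (B : Fml V W s'),
    Q (c.plug (.prepend [A] (.single B))) → Q (c.plug (.single (.mul A B)))
  ldivL : ∀ {s' : Srt} (c : Cx V W s' s) (P : List (Fml V W .fin)) (B : Fml V W .fin)
    (A : Fml V W s'), Q (c.plug (.single A)) → Der (.fin P) B →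
    Q (c.plug (.prepend P (.single (.ldiv B A))))
  rdivL : ∀ {s' : Srt} (c : Cx V W s' s) (X : Ante V W s') (A D : Fml V W s'),
    Q (c.plug (.single A)) → Der X D → Q (c.plug (.prepend [.rdiv A D] X))
  andL₁ : ∀ {s' : Srt} (c : Cx V W s' s) (A B : Fml V W s'),
    Q (c.plug (.single A)) → Q (c.plug (.single (.and A B)))
  andL₂ : ∀ {s' : Srt} (c : Cx V W s' s) (A B : Fml V W s'),
    Q (c.plug (.single B)) → Q (c.plug (.single (.and A B)))
  orL : ∀ {s' : Srt} (c : Cx V W s' s) (A B : Fml V W s'),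
    Q (c.plug (.single A)) → Q (c.plug (.single B)) → Q (c.plug (.single (.or A B)))
  starL : ∀ (c : Cx V W .fin s) (A : Fml V W .fin),
    (∀ n : ℕ, Q (c.plug (.fin (List.replicate n A)))) → Q (c.plug (.single (.star A)))
  omegaL : ∀ (c : Cx V W .om s) (A : Fml V W .fin),
    Q (c.plug (.inf (Stream'.const A))) → Q (c.plug (.single (.omega A)))
  Lω : ∀ (c : Cx V W .om s) (Δ : ℕ → List (Fml V W .fin)) (M : ℕ → Set (Ante V W .fin))
    (θ : Stream' (Fml V W .fin)), IsConcat Δ θ → (∀ i, Red (.fin (Δ i)) (M i)) →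
    (∀ (Γ : ℕ → List (Fml V W .fin)) (g : Stream' (Fml V W .fin)),
      (∀ i, Ante.fin (Γ i) ∈ M i) → IsConcat Γ g → Q (c.plug (.inf g))) →
    Q (c.plug (.inf θ))

theorem leftClosed_der {s : Srt} (C : Fml V W s) : LeftClosed fun Θ => Der Θ C where
  mulL c A B := Der.mulL c A B C
  ldivL c P B A := Der.ldivL c P B A C
  rdivL c X A D := Der.rdivL c X A D C
  andL₁ c A B := Der.andL₁ c A B C
  andL₂ c A B := Der.andL₂ c A B C
  orL c A B := Der.orL c A B C
  starL c A := Der.starL c A C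
  omegaL c A := Der.omegaL c A C
  Lω c Δ M θ hθ hM hQ := by
    cases c with
    | last Γ₀ =>
      -- The prefix `Γ₀` becomes block `0`, with itself as its only reduct.
      refine Der.Lω (consSeq Γ₀ Δ) (consSeq {Ante.fin Γ₀} M) _ C (hθ.consSeq Γ₀) (fun i => ?_)
        fun Γ g hΓ hg => ?_
      · cases i with
        | zero => exact Red.hyp _
        | succ i => exact hM i
      · obtain ⟨t, rfl, ht⟩ := hg.succ
        have h0 : Γ 0 = Γ₀ := Ante.fin.inj (hΓ 0)
        rw [h0]
        exact hQ _ t (fun i => hΓ (i + 1)) ht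

/-- Left rules ending a derivation of `X ⊢ F` act in a context inside `X`; nesting contexts lets
them act where `X` has replaced `F`. -/
theorem LeftClosed.comp {s₁ s : Srt} {Q : Ante V W s → Prop} (hQ : LeftClosed Q)
    (c : Cx V W s₁ s) : LeftClosed fun X => Q (c.plug X) where
  mulL d A B h := by
    rw [← Cx.plug_comp] at h ⊢
    exact hQ.mulL _ A B h
  ldivL d P B A h hB := by
    rw [← Cx.plug_comp] at h ⊢
    exact hQ.ldivL _ P B A h hB
  rdivL d X A D h hD := by
    rw [← Cx.plug_comp] at h ⊢
    exact hQ.rdivL _ X A D h hD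
  andL₁ d A B h := by
    rw [← Cx.plug_comp] at h ⊢
    exact hQ.andL₁ _ A B h
  andL₂ d A B h := by
    rw [← Cx.plug_comp] at h ⊢
    exact hQ.andL₂ _ A B h
  orL d A B h h' := by
    rw [← Cx.plug_comp] at h h' ⊢
    exact hQ.orL _ A B h h'
  starL d A h := by
    simp only [← Cx.plug_comp] at h ⊢
    exact hQ.starL _ A h
  omegaL d A h := by
    rw [← Cx.plug_comp] at h ⊢
    exact hQ.omegaL _ A h
  Lω d Δ M θ hθ hM h := by
    simp only [← Cx.plug_comp] at h ⊢
    exact hQ.Lω _ Δ M θ hθ hM h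

/-- The antecedents that reduce to members of a given set of finite sequences are closed under the
left rules. -/
theorem leftClosed_red (S : Set (Ante V W .fin)) :
    LeftClosed fun Θ : Ante V W .fin => ∃ M, Red Θ M ∧ M ⊆ S where
  mulL c A B := fun ⟨M, h, hM⟩ => ⟨M, .mulL c A B M h, hM⟩
  ldivL c P B A := fun ⟨M, h, hM⟩ hB => ⟨M, .ldivL c P B A M h hB, hM⟩
  rdivL c X A D := fun ⟨M, h, hM⟩ hD => ⟨M, .rdivL c X A D M h hD, hM⟩
  andL₁ c A B := fun ⟨M, h, hM⟩ => ⟨M, .andL₁ c A B M h, hM⟩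
  andL₂ c A B := fun ⟨M, h, hM⟩ => ⟨M, .andL₂ c A B M h, hM⟩
  orL c A B := fun ⟨M, h, hM⟩ ⟨N, h', hN⟩ =>
    ⟨M ∪ N, .orL c A B M N h h', Set.union_subset hM hN⟩
  starL c A h := by
    choose M hR hM using h
    exact ⟨⋃ n, M n, .starL c A M hR, Set.iUnion_subset hM⟩
  -- A sequence of finite sort has no hole of sort `om`, so neither this rule nor `Lω` applies to
  -- it.
  omegaL c A := by cases c
  Lω c := by cases c

/-! ### Derivations ending in a right rule -/

/-- `RightForm A X`: the sequent `X ⊢ A` is the conclusion of a right rule with derivable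
premises. -/
def RightForm : {s : Srt} → Fml V W s → Ante V W s → Prop
  | _, .fvar _, _ => False
  | _, .ovar _, _ => False
  | _, .mul A B, X => ∃ Γ Θ, X = .prepend Γ Θ ∧ Der (.fin Γ) A ∧ Der Θ B
  | _, .ldiv B A, X => Der (.prepend [B] X) A
  | _, .rdiv A B, X => ∃ P, X = .fin P ∧ Der (.prepend P (.single B)) A
  | _, .or A B, X => Der X A ∨ Der X B
  | _, .and A B, X => Der X A ∧ Der X B
  | _, .star A, X => ∃ P : List (List (Fml V W .fin)), X = .fin P.flatten ∧
      ∀ Q ∈ P, Der (.fin Q) A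
  | _, .omega A, X => ∃ Γ θ, X = .inf θ ∧ IsConcat Γ θ ∧ ∀ i, Der (.fin (Γ i)) A

/-- The left rules at the end of a derivation of `X ⊢ A` can be carried over to any predicate that
is closed under them. -/
theorem LeftClosed.of_der {s : Srt} {X : Ante V W s} {A : Fml V W s} (h : Der X A) :
    ∀ {Q : Ante V W s → Prop}, LeftClosed Q → Q (.single A) → (∀ Y, RightForm A Y → Q Y) →
      Q X := by
  -- Reductions and minor premises are carried over unchanged, so nothing has to be proved about
  -- `Red`.
  refine Der.rec
    (motive_1 := fun {s} X A _ => ∀ {Q : Ante V W s → Prop}, LeftClosed Q → Q (.single A) →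
      (∀ Y, RightForm A Y → Q Y) → Q X)
    (motive_2 := fun _ _ _ => True)
    ?_ ?_ ?_ ?_ ?_ ?_ ?_ ?_ ?_ ?_ ?_ ?_ ?_ ?_ ?_ ?_ ?_ ?_
    ?_ ?_ ?_ ?_ ?_ ?_ ?_ ?_ ?_ h
  · intro s A Q _ hA _
    exact hA
  · intro s' s c A B E _ ih Q hQ hA hR
    exact hQ.mulL c A B (ih hQ hA hR)
  · intro s' s c P B A E _ hB ih _ Q hQ hA hR
    exact hQ.ldivL c P B A (ih hQ hA hR) hB
  · intro s' s c X A D E _ hD ih _ Q hQ hA hR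
    exact hQ.rdivL c X A D (ih hQ hA hR) hD
  · intro s' s c A B E _ ih Q hQ hA hR
    exact hQ.andL₁ c A B (ih hQ hA hR)
  · intro s' s c A B E _ ih Q hQ hA hR
    exact hQ.andL₂ c A B (ih hQ hA hR)
  · intro s' s c A B E _ _ ih ih' Q hQ hA hR
    exact hQ.orL c A B (ih hQ hA hR) (ih' hQ hA hR)
  · intro s c A E _ ih Q hQ hA hR
    exact hQ.starL c A fun n => ih n hQ hA hR
  · intro s c A E _ ih Q hQ hA hR
    exact hQ.omegaL c A (ih hQ hA hR)
  · intro Δ M θ C hθ hM _ _ ih Q hQ hA hR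
    have := hQ.Lω (Cx.hole .om) Δ M θ hθ hM
    simp only [Cx.plug_hole] at this
    exact this fun Γ g hΓ hg => ih Γ g hΓ hg hQ hA hR
  · intro Γ θ A hθ hA _ Q _ _ hR
    exact hR _ ⟨Γ, θ, rfl, hθ, hA⟩
  · intro s P A B h _ Q _ _ hR
    exact hR _ ⟨P, rfl, h⟩
  · intro s Θ B A h _ Q _ _ hR
    exact hR _ h
  · intro s Γ Θ A B h h' _ _ Q _ _ hR
    exact hR _ ⟨Γ, Θ, rfl, h, h'⟩
  · intro s Θ A B h h' _ _ Q _ _ hR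
    exact hR _ ⟨h, h'⟩
  · intro s Θ A B h _ Q _ _ hR
    exact hR _ (.inl h)
  · intro s Θ A B h _ Q _ _ hR
    exact hR _ (.inr h)
  · intro P A h _ Q _ _ hR
    exact hR _ ⟨P, rfl, h⟩
  all_goals intros; trivial

end LeftRules

section Mix

variable {V : Type u} {W : Type v} {K : ℕ}

/-! ### Admissibility of mix -/

/-- Derivability is preserved when formulae of size at most `K` in the antecedent are replaced by
sequences from which they are derivable. -/
def MixBelow (V : Type u) (W : Type v) (K : ℕ) : Prop :=
  ∀ {s : Srt} {Θ Θ' : Ante V W s} {C : Fml V W s}, Der Θ C → AnteSub K Θ Θ' → Der Θ' C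

/-- The images of `Θ` under replacement of formulae satisfy `Q`. -/
def Stable (K : ℕ) {s : Srt} (Q : Ante V W s → Prop) (Θ : Ante V W s) : Prop :=
  ∀ Θ', AnteSub K Θ Θ' → Q Θ'

/-- This is the case split on a principal formula: either it stays, and the left rule is applied
again, or its derivation is traced back to axioms, treated like the first case, and right rules. The
size bound is available only for the right rules. -/
theorem LeftClosed.of_rep {s : Srt} {Q : Ante V W s → Prop} (hQ : LeftClosed Q) {F : Fml V W s}
    {X : Ante V W s} (hX : FmlRep K F X) (hF : Q (.single F))
    (hR : F.size ≤ K → ∀ Y, RightForm F Y → Q Y) : Q X := by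
  rcases hX with rfl | ⟨hK, hX⟩
  · exact hF
  · exact LeftClosed.of_der hX hQ hF (hR hK)

-- Left rules under replacement

section Steps

variable {s' s : Srt} {Q : Ante V W s → Prop}

theorem LeftClosed.stable_mulL (hQ : LeftClosed Q) {c : Cx V W s' s} {A : Fml V W .fin}
    {B : Fml V W s'} (h : Stable K Q (c.plug (.prepend [A] (.single B)))) :
    Stable K Q (c.plug (.single (.mul A B))) := by
  intro Z hZ
  obtain ⟨c', X, rfl, hc, hX⟩ := hZ.exists_plug
  refine (hQ.comp c').of_rep hX.rep (hQ.mulL c' A B (h _ (hc.plug (.refl _)))) fun hK Y hY => ?_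
  obtain ⟨Γ, Θ, rfl, hA, hB⟩ := hY
  simp only [Fml.size] at hK
  -- The premises of `·R` turn `Γ, Θ` into an image of `A, B`, so the hypothesis on the premise of
  -- `·L` covers it together with the changed context.
  exact h _ (hc.plug (.prepend (.singleton (.inr ⟨by omega, hA⟩))
    (.single (.inr ⟨by omega, hB⟩))))

theorem LeftClosed.stable_ldivL (H : ∀ k < K, MixBelow V W k) (hQ : LeftClosed Q)
    {c : Cx V W s' s} {P : List (Fml V W .fin)} {B : Fml V W .fin} {A : Fml V W s'}
    (h : Stable K Q (c.plug (.single A))) (hB : Stable K (fun Θ => Der Θ B) (.fin P)) :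
    Stable K Q (c.plug (.prepend P (.single (.ldiv B A)))) := by
  intro Z hZ
  obtain ⟨c', Z', rfl, hc, hZ'⟩ := hZ.exists_plug
  obtain ⟨P', X, rfl, hP, hX⟩ := hZ'.exists_prepend
  have hB' : Der (.fin P') B := hB _ (.fin hP)
  -- `P'` is held fixed to the left of the hole, which is to receive the replacement of `B \ A`.
  have hQ' := (hQ.comp c').comp ((Cx.hole s').prepend P')
  simp only [Cx.plug_prepend, Cx.plug_hole] at hQ'
  refine hQ'.of_rep hX.rep (hQ.ldivL c' P' B A (h _ (hc.plug (.refl _))) hB') fun hK Y hY => ?_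
  simp only [Fml.size] at hK
  -- The cut on `B`, smaller than `B \ A`, uses the outer hypothesis; `P', Y` may then replace `A`.
  have hA : Der (Y.prepend P') A := H B.size (by omega) hY
    (.prepend (.singleton (.inr ⟨le_rfl, hB'⟩)) (.refl Y))
  exact h _ (hc.plug (.single (.inr ⟨by omega, hA⟩)))

theorem LeftClosed.stable_rdivL (H : ∀ k < K, MixBelow V W k) (hQ : LeftClosed Q)
    {c : Cx V W s' s} {X : Ante V W s'} {A D : Fml V W s'}
    (h : Stable K Q (c.plug (.single A))) (hD : Stable K (fun Θ => Der Θ D) X) :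
    Stable K Q (c.plug (.prepend [.rdiv A D] X)) := by
  intro Z hZ
  obtain ⟨c', Z', rfl, hc, hZ'⟩ := hZ.exists_plug
  obtain ⟨P', X', rfl, hP, hX⟩ := hZ'.exists_prepend
  have hD' : Der X' D := hD _ hX
  have hQ' := (hQ.comp c').comp (Cx.mid [] X')
  have key : Q (c'.plug ((Cx.mid [] X').plug (.fin P'))) := by
    refine hQ'.of_rep hP.of_singleton ?_ fun hK Y hY => ?_
    · have := hQ.rdivL c' X' A D (h _ (hc.plug (.refl _))) hD'
      simpa only [Cx.plug, Ante.single, Ante.prepend_nil] using this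
    · obtain ⟨P, rfl, hA⟩ := hY
      simp only [Fml.size] at hK
      -- The smaller cut is on `D`; afterwards `P, X'` may replace `A`.
      have hA' : Der (X'.prepend P) A := H D.size (by omega) hA
        (.prepend (.refl ListRep.refl P) (.single (.inr ⟨le_rfl, hD'⟩)))
      simp only [Cx.plug, Ante.prepend_nil]
      exact h _ (hc.plug (.single (.inr ⟨by omega, hA'⟩)))
  simpa only [Cx.plug, Ante.prepend_nil] using key

theorem LeftClosed.stable_andL₁ (hQ : LeftClosed Q) {c : Cx V W s' s} {A B : Fml V W s'}
    (h : Stable K Q (c.plug (.single A))) : Stable K Q (c.plug (.single (.and A B))) := by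
  intro Z hZ
  obtain ⟨c', X, rfl, hc, hX⟩ := hZ.exists_plug
  refine (hQ.comp c').of_rep hX.rep (hQ.andL₁ c' A B (h _ (hc.plug (.refl _)))) fun hK Y hY => ?_
  simp only [Fml.size] at hK
  exact h _ (hc.plug (.single (.inr ⟨by omega, hY.1⟩)))

theorem LeftClosed.stable_andL₂ (hQ : LeftClosed Q) {c : Cx V W s' s} {A B : Fml V W s'}
    (h : Stable K Q (c.plug (.single B))) : Stable K Q (c.plug (.single (.and A B))) := by
  intro Z hZ
  obtain ⟨c', X, rfl, hc, hX⟩ := hZ.exists_plug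
  refine (hQ.comp c').of_rep hX.rep (hQ.andL₂ c' A B (h _ (hc.plug (.refl _)))) fun hK Y hY => ?_
  simp only [Fml.size] at hK
  exact h _ (hc.plug (.single (.inr ⟨by omega, hY.2⟩)))

theorem LeftClosed.stable_orL (hQ : LeftClosed Q) {c : Cx V W s' s} {A B : Fml V W s'}
    (hA : Stable K Q (c.plug (.single A))) (hB : Stable K Q (c.plug (.single B))) :
    Stable K Q (c.plug (.single (.or A B))) := by
  intro Z hZ
  obtain ⟨c', X, rfl, hc, hX⟩ := hZ.exists_plug
  refine (hQ.comp c').of_rep hX.rep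
    (hQ.orL c' A B (hA _ (hc.plug (.refl _))) (hB _ (hc.plug (.refl _)))) fun hK Y hY => ?_
  simp only [Fml.size] at hK
  rcases hY with hY | hY
  · exact hA _ (hc.plug (.single (.inr ⟨by omega, hY⟩)))
  · exact hB _ (hc.plug (.single (.inr ⟨by omega, hY⟩)))

theorem LeftClosed.stable_starL (hQ : LeftClosed Q) {c : Cx V W .fin s} {A : Fml V W .fin}
    (h : ∀ n, Stable K Q (c.plug (.fin (List.replicate n A)))) :
    Stable K Q (c.plug (.single (.star A))) := by
  intro Z hZ
  obtain ⟨c', X, rfl, hc, hX⟩ := hZ.exists_plug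
  refine (hQ.comp c').of_rep hX.rep
    (hQ.starL c' A fun n => h n _ (hc.plug (.refl _))) fun hK Y hY => ?_
  simp only [Fml.size] at hK
  obtain ⟨P, rfl, hP⟩ := hY
  -- The number of premises of `*R` selects the premise of `*L`.
  exact h P.length _ (hc.plug (.fin (.replicate fun p hp => .inr ⟨by omega, hP p hp⟩)))

theorem LeftClosed.stable_omegaL (hQ : LeftClosed Q) {c : Cx V W .om s} {A : Fml V W .fin}
    (h : Stable K Q (c.plug (.inf (Stream'.const A)))) :
    Stable K Q (c.plug (.single (.omega A))) := by
  intro Z hZ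
  obtain ⟨c', X, rfl, hc, hX⟩ := hZ.exists_plug
  refine (hQ.comp c').of_rep hX.rep
    (hQ.omegaL c' A (h _ (hc.plug (.refl _)))) fun hK Y hY => ?_
  simp only [Fml.size] at hK
  obtain ⟨Γ, θ, rfl, hθ, hΓ⟩ := hY
  exact h _ (hc.plug (.inf ⟨Γ, fun i => .inr ⟨by simp only [Stream'.get_const]; omega, hΓ i⟩, hθ⟩))

end Steps

/-- The replacement is distributed over the blocks `Δ i`. Each new block reduces to images of
members of `M i`, so every new premise is an image of an old one. -/
theorem stable_Lω {Δ : ℕ → List (Fml V W .fin)} {M : ℕ → Set (Ante V W .fin)}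
    {θ : Stream' (Fml V W .fin)} {C : Fml V W .om} (hθ : IsConcat Δ θ)
    (hM : ∀ i (Q : Ante V W .fin → Prop), LeftClosed Q → (∀ Ξ ∈ M i, Stable K Q Ξ) →
      Stable K Q (.fin (Δ i)))
    (h : ∀ (Γ : ℕ → List (Fml V W .fin)) (g : Stream' (Fml V W .fin)),
      (∀ i, Ante.fin (Γ i) ∈ M i) → IsConcat Γ g → Stable K (fun Θ => Der Θ C) (.inf g)) :
    Stable K (fun Θ => Der Θ C) (.inf θ) := by
  intro Z hZ
  obtain ⟨g, rfl, hg⟩ := hZ.exists_inf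
  obtain ⟨Δ', hΔ', hs⟩ := hg.exists_isConcat hθ
  have hred (i : ℕ) : ∃ M', Red (.fin (Δ' i)) M' ∧ M' ⊆ {Ξ' | ∃ Ξ ∈ M i, AnteSub K Ξ Ξ'} :=
    -- The predicate chosen is reducibility to images of members of `M i`; such an image satisfies
    -- it by `Red.hyp`.
    hM i (fun Θ => ∃ M', Red Θ M' ∧ M' ⊆ {Ξ' | ∃ Ξ ∈ M i, AnteSub K Ξ Ξ'}) (leftClosed_red _)
      (fun Ξ hΞ Ξ' hs => ⟨{Ξ'}, .hyp Ξ', Set.singleton_subset_iff.2 ⟨Ξ, hΞ, hs⟩⟩)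
      _ (.fin (hs i))
  choose M' hR hM' using hred
  refine Der.Lω Δ' M' g C hΔ' hR fun Γ' g' hΓ' hg' => ?_
  have hΓ (i : ℕ) : ∃ Γ, Ante.fin Γ ∈ M i ∧ ListSub (ListRep K) Γ (Γ' i) := by
    obtain ⟨⟨Γ⟩, hΓ, hs⟩ := hM' i (hΓ' i)
    exact ⟨Γ, hΓ, anteSub_fin_iff.1 hs⟩
  choose Γ hΓM hΓs using hΓ
  obtain ⟨f, hf, hfg⟩ := exists_streamSub hg' hΓs
  exact h Γ f hΓM hf _ (.inf hfg)

theorem mixBelow_of_lt (H : ∀ k < K, MixBelow V W k) : MixBelow V W K := by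
  intro s Θ Θ' C hder
  suffices h : Stable K (fun Θ' => Der Θ' C) Θ from h Θ'
  -- The motive for `Red` quantifies over all `LeftClosed` predicates, so that `stable_Lω` can
  -- choose reducibility.
  refine Der.rec
    (motive_1 := fun {s} Θ C _ => Stable K (fun Θ' => Der Θ' C) Θ)
    (motive_2 := fun {s} Θ M _ => ∀ Q : Ante V W s → Prop, LeftClosed Q →
      (∀ Ξ ∈ M, Stable K Q Ξ) → Stable K Q Θ)
    ?_ ?_ ?_ ?_ ?_ ?_ ?_ ?_ ?_ ?_ ?_ ?_ ?_ ?_ ?_ ?_ ?_ ?_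
    ?_ ?_ ?_ ?_ ?_ ?_ ?_ ?_ ?_ hder
  · intro s A Z hZ
    exact hZ.rep.der
  · intro s' s c A B E _ ih
    exact (leftClosed_der E).stable_mulL ih
  · intro s' s c P B A E _ _ ih ihB
    exact (leftClosed_der E).stable_ldivL H ih ihB
  · intro s' s c X A D E _ _ ih ihD
    exact (leftClosed_der E).stable_rdivL H ih ihD
  · intro s' s c A B E _ ih
    exact (leftClosed_der E).stable_andL₁ ih
  · intro s' s c A B E _ ih
    exact (leftClosed_der E).stable_andL₂ ih
  · intro s' s c A B E _ _ ih ih'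
    exact (leftClosed_der E).stable_orL ih ih'
  · intro s c A E _ ih
    exact (leftClosed_der E).stable_starL ih
  · intro s c A E _ ih
    exact (leftClosed_der E).stable_omegaL ih
  · intro Δ M θ C hθ _ _ ihM ih
    exact stable_Lω hθ ihM ih
  · intro Γ θ A hθ _ ih Z hZ
    obtain ⟨g, rfl, hg⟩ := hZ.exists_inf
    obtain ⟨Γ', hΓ', hs⟩ := hg.exists_isConcat hθ
    exact .omegaR Γ' g A hΓ' fun i => ih i _ (.fin (hs i))
  · intro s P A B _ ih Z hZ
    obtain ⟨P', rfl, hP⟩ := hZ.exists_fin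
    exact .rdivR P' A B (ih _ (.prepend hP (.refl _)))
  · intro s Θ B A _ ih Z hZ
    exact .ldivR Z B A (ih _ (.prepend (.refl ListRep.refl _) hZ))
  · intro s Γ Θ A B _ _ ihA ihB Z hZ
    obtain ⟨Γ', Θ', rfl, hΓ, hΘ⟩ := hZ.exists_prepend
    exact .mulR Γ' Θ' A B (ihA _ (.fin hΓ)) (ihB _ hΘ)
  · intro s Θ A B _ _ ihA ihB Z hZ
    exact .andR Z A B (ihA Z hZ) (ihB Z hZ)
  · intro s Θ A B _ ih Z hZ
    exact .orR₁ Z A B (ih Z hZ)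
  · intro s Θ A B _ ih Z hZ
    exact .orR₂ Z A B (ih Z hZ)
  · intro P A _ ih Z hZ
    obtain ⟨L, rfl, hL⟩ := hZ.exists_fin
    obtain ⟨P', rfl, hP'⟩ := hL.exists_flatten
    refine .starR P' A fun p hp => ?_
    obtain ⟨q, hq, hs⟩ := hP' p hp
    exact ih q hq _ (.fin hs)
  · intro s Θ Q _ hM
    exact hM Θ rfl
  · intro s' s c A B M _ ih Q hQ hM
    exact hQ.stable_mulL (ih Q hQ hM)
  · intro s' s c P B A M _ _ ih ihB Q hQ hM
    exact hQ.stable_ldivL H (ih Q hQ hM) ihB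
  · intro s' s c X A D M _ _ ih ihD Q hQ hM
    exact hQ.stable_rdivL H (ih Q hQ hM) ihD
  · intro s' s c A B M _ ih Q hQ hM
    exact hQ.stable_andL₁ (ih Q hQ hM)
  · intro s' s c A B M _ ih Q hQ hM
    exact hQ.stable_andL₂ (ih Q hQ hM)
  · intro s' s c A B M N _ _ ih ih' Q hQ hM
    exact hQ.stable_orL (ih Q hQ fun Ξ h => hM Ξ (.inl h)) (ih' Q hQ fun Ξ h => hM Ξ (.inr h))
  · intro s c A M _ ih Q hQ hM
    exact hQ.stable_starL fun n => ih n Q hQ fun Ξ h => hM Ξ (Set.mem_iUnion_of_mem n h)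
  · intro s c A M _ ih Q hQ hM
    exact hQ.stable_omegaL (ih Q hQ hM)

theorem mixBelow (V : Type u) (W : Type v) (K : ℕ) : MixBelow V W K := by
  induction K using Nat.strong_induction_on with
  | _ K ih => exact mixBelow_of_lt ih

/-! ### The mix rules, cut and invertibility -/

theorem listSub_finBlocks {n : ℕ} (S : List (Fml V W .fin)) {A : Fin n → Fml V W .fin}
    {P : Fin n → List (Fml V W .fin)} (Q : Fin n → List (Fml V W .fin))
    (hA : ∀ i, (A i).size ≤ K) (hP : ∀ i, Der (.fin (P i)) (A i)) :
    ListSub (ListRep K) (finBlocks S (fun i => [A i]) Q) (finBlocks S P Q) := by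
  refine .append (.refl ListRep.refl S) ?_
  induction n with
  | zero => simpa using ListSub.nil
  | succ n ih =>
    simp only [List.ofFn_succ, List.flatten_cons]
    exact .append (.append (.singleton (.inr ⟨hA 0, hP 0⟩)) (.refl ListRep.refl _))
      (ih (fun i => Q i.succ) (fun i => hA i.succ) fun i => hP i.succ)

theorem exists_size_le {n : ℕ} (A : Fin n → Fml V W .fin) : ∃ K, ∀ i, (A i).size ≤ K :=
  ⟨Finset.univ.sup fun i => (A i).size,
    fun i => Finset.le_sup (f := fun i => (A i).size) (Finset.mem_univ i)⟩

theorem mixFinAdmissible (V : Type u) (W : Type v) (n : ℕ) : MixFinAdmissible V W n := by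
  intro s S A P Q Θ C hP h
  obtain ⟨K, hK⟩ := exists_size_le A
  exact mixBelow V W K h (.prepend (listSub_finBlocks S Q hK hP) (.refl Θ))

theorem mixFinOmAdmissible (V : Type u) (W : Type v) (n : ℕ) : MixFinOmAdmissible V W n := by
  intro S A P Q X B C hP hX h
  obtain ⟨K, hK⟩ := exists_size_le A
  exact mixBelow V W (max K B.size) h
    (.prepend (listSub_finBlocks S Q (fun i => (hK i).trans (le_max_left _ _)) hP)
      (.single (.inr ⟨le_max_right _ _, hX⟩)))

theorem mixOmegaAdmissible (V : Type u) (W : Type v) : MixOmegaAdmissible V W := by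
  rintro S A P Q f g C ⟨K, hK⟩ hf hg hP h
  obtain ⟨f', hf', hs⟩ := exists_streamSub (r := ListRep K) (Γ := fun i => [A i] ++ Q i) hg
    fun i => .append (.singleton (.inr ⟨hK i, hP i⟩)) (.refl ListRep.refl _)
  -- The source recovered from `g` is `f`, because a sequence of lists has at most one infinite
  -- concatenation.
  rw [← hf.unique hf'] at hs
  exact mixBelow V W K h (.prepend (.refl ListRep.refl S) (.inf hs))

theorem cutAdmissible (V : Type u) (W : Type v) : CutAdmissible V W := by
  intro s' s c X A C hX h
  exact mixBelow V W A.size h ((CxSub.refl c).plug (.single (.inr ⟨le_rfl, hX⟩)))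

theorem Der.cut_prepend {s : Srt} {Γ : List (Fml V W .fin)} {X : Ante V W s} {A C : Fml V W s}
    (hX : Der X A) (h : Der (.prepend Γ (.single A)) C) : Der (X.prepend Γ) C := by
  have := cutAdmissible V W s s ((Cx.hole s).prepend Γ) X A C hX
  simp only [Cx.plug_prepend, Cx.plug_hole] at this
  exact this h

theorem Der.cut_fin {s : Srt} {P : List (Fml V W .fin)} {Θ : Ante V W s} {A : Fml V W .fin}
    {C : Fml V W s} (hP : Der (.fin P) A) (h : Der (.prepend [A] Θ) C) : Der (Θ.prepend P) C := by
  have := cutAdmissible V W .fin s (.mid [] Θ) (.fin P) A C hP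
  simp only [Cx.plug, Ante.single, Ante.prepend_nil] at this
  exact this h

theorem Der.cut_single {s : Srt} {X : Ante V W s} {A C : Fml V W s}
    (hX : Der X A) (h : Der (.single A) C) : Der X C := by
  have := Der.cut_prepend (Γ := []) (C := C) hX
  simp only [Ante.prepend_nil] at this
  exact this h

-- Derivable sequents used for invertibility

theorem der_single_and_left {s : Srt} (A B : Fml V W s) : Der (.single (.and A B)) A := by
  have := Der.andL₁ (Cx.hole s) A B A
  simp only [Cx.plug_hole] at this
  exact this (.ax A)

theorem der_single_and_right {s : Srt} (A B : Fml V W s) : Der (.single (.and A B)) B := by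
  have := Der.andL₂ (Cx.hole s) A B B
  simp only [Cx.plug_hole] at this
  exact this (.ax B)

theorem der_ldiv {s : Srt} (B : Fml V W .fin) (A : Fml V W s) :
    Der (.prepend [B] (.single (.ldiv B A))) A := by
  have := Der.ldivL (Cx.hole s) [B] B A A
  simp only [Cx.plug_hole] at this
  exact this (.ax A) (.ax B)

theorem der_rdiv {s : Srt} (A B : Fml V W s) : Der (.prepend [.rdiv A B] (.single B)) A := by
  have := Der.rdivL (Cx.hole s) (.single B) A B A
  simp only [Cx.plug_hole] at this
  exact this (.ax A) (.ax B)

theorem der_star_replicate (A : Fml V W .fin) (n : ℕ) :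
    Der (.fin (List.replicate n A)) (.star A) := by
  have := Der.starR (List.replicate n [A]) A fun Q hQ => by
    rw [List.eq_of_mem_replicate hQ]
    exact .ax A
  simpa using this

theorem der_omega_const (A : Fml V W .fin) : Der (.inf (Stream'.const A)) (.omega A) :=
  .omegaR _ _ A (.singleton (Stream'.const A)) fun _ => .ax A

end Mix

theorem mainTheorem1 (V : Type*) (W : Type*) :
    -- the mix rule is admissible for every `α ≤ ω`
    (∀ n : ℕ, MixFinAdmissible V W n ∧ MixFinOmAdmissible V W n) ∧
    MixOmegaAdmissible V W ∧
    -- cut is admissible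
    CutAdmissible V W ∧
    -- `∨L` is invertible
    (∀ (s' s : Srt) (c : Cx V W s' s) (A B : Fml V W s') (E : Fml V W s),
      Der (c.plug (.single (.or A B))) E →
        Der (c.plug (.single A)) E ∧ Der (c.plug (.single B)) E) ∧
    -- `∧R` is invertible
    (∀ (s : Srt) (Θ : Ante V W s) (A B : Fml V W s),
      Der Θ (.and A B) → Der Θ A ∧ Der Θ B) ∧
    -- `·L` is invertible
    (∀ (s' s : Srt) (c : Cx V W s' s) (A : Fml V W .fin) (B : Fml V W s') (E : Fml V W s),
      Der (c.plug (.single (.mul A B))) E → Der (c.plug (.prepend [A] (.single B))) E) ∧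
    -- `\R` is invertible
    (∀ (s : Srt) (Θ : Ante V W s) (B : Fml V W .fin) (A : Fml V W s),
      Der Θ (.ldiv B A) → Der (.prepend [B] Θ) A) ∧
    -- `/R` is invertible
    (∀ (s : Srt) (P : List (Fml V W .fin)) (A B : Fml V W s),
      Der (.fin P) (.rdiv A B) → Der (.prepend P (.single B)) A) ∧
    -- `*L` is invertible
    (∀ (s : Srt) (c : Cx V W .fin s) (A : Fml V W .fin) (E : Fml V W s),
      Der (c.plug (.single (.star A))) E →
        ∀ n : ℕ, Der (c.plug (.fin (List.replicate n A))) E) ∧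
    -- `^ωL` is invertible
    (∀ (s : Srt) (c : Cx V W .om s) (A : Fml V W .fin) (E : Fml V W s),
      Der (c.plug (.single (.omega A))) E → Der (c.plug (.inf (Stream'.const A))) E) := by
  have cut := cutAdmissible V W
  refine ⟨fun n => ⟨mixFinAdmissible V W n, mixFinOmAdmissible V W n⟩, mixOmegaAdmissible V W,
    cut, ?_, ?_, ?_, ?_, ?_, ?_, ?_⟩
  · intro s' s c A B E h
    -- For left rules, the active part of each premise derives the principal formula, which is then
    -- cut. For right rules, the principal formula is cut into a sequent that decomposes it.
    exact ⟨cut _ _ c _ _ E (.orR₁ _ A B (.ax A)) h, cut _ _ c _ _ E (.orR₂ _ A B (.ax B)) h⟩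
  · intro s Θ A B h
    exact ⟨h.cut_single (der_single_and_left A B), h.cut_single (der_single_and_right A B)⟩
  · intro s' s c A B E h
    exact cut _ _ c _ _ E (.mulR [A] (.single B) A B (.ax A) (.ax B)) h
  · intro s Θ B A h
    exact h.cut_prepend (der_ldiv B A)
  · intro s P A B h
    exact h.cut_fin (der_rdiv A B)
  · intro s c A E h n
    exact cut _ _ c _ _ E (der_star_replicate A n) h
  · intro s c A E h
    exact cut _ _ c _ _ E (der_omega_const A) h
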